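/- There is an absolute constant $C>0$ such that the following holds. Let $\Gamma$ be a finite vertex-transitive graph (simple, undirected, unweighted) with vertex set $V$ and $n=|V|\ge 2$ vertices. Then there is a basis $b_1,\dots,b_n$ of the real vector space $\mathbb{R}^V$ such that each $b_i$ is an eigenvector of the adjacency matrix of $\Gamma$ and, with respect to the averaging measure on $V$, $$\frac1n\sum_{v\in V} b_i(v)\,b_j(v)=\begin{cases}1,& i=j,\\ 0,& i\neq j,\end{cases}\qquad\text{and}\qquad \max_{v\in V}|b_i(v)|\le C\sqrt{\log n}\quad\text{for all } i,j\in\{1,\dots,n\}.$$ -/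

import Mathlib

open scoped BigOperators

/-- A graph is vertex-transitive if its automorphism group acts transitively on its vertices. -/
def IsVertexTransitive {V : Type*} (G : SimpleGraph V) : Prop :=
  ∀ u v : V, ∃ φ : G ≃g G, φ u = v

/-- The inner product on real functions on a finite set with respect to the averaging
(uniform probability) measure: `⟨x, y⟩ = 𝔼 s, x s * y s`. -/
noncomputable def avgInner {S : Type*} [Fintype S] (x y : S → ℝ) : ℝ :=
  𝔼 s, x s * y s

/-- A family of real functions on `S` is orthonormal with respect to the averaging measure. -/
def IsAvgOrthonormal {S ι : Type*} [Fintype S] (b : ι → S → ℝ) : Prop :=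
  (∀ i, avgInner (b i) (b i) = 1) ∧ ∀ i j, i ≠ j → avgInner (b i) (b j) = 0

/-- A real function on a finite set is `K`-bounded if its `L^∞` norm is at most `K`
(the norm on `S → ℝ` is the sup norm). -/
def IsBoundedBy {S : Type*} [Fintype S] (K : ℝ) (x : S → ℝ) : Prop :=
  ‖x‖ ≤ K

/-- A real eigenfunction of (the adjacency matrix of) a finite graph:
a nonzero `x` with `A x = μ x` for some real number `μ`. -/
def IsEigenfunction {V : Type*} [Fintype V] (G : SimpleGraph V) [DecidableRel G.Adj]
    (x : V → ℝ) : Prop :=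
  ∃ μ : ℝ, Module.End.HasEigenvector (G.adjMatrix ℝ).mulVecLin μ x

/-! Automorphisms preserve each eigenspace `W`. For an orthonormal basis `e` of `W`, with `d = dim
W`, transitivity makes `∑ j, e j v ^ 2` independent of `v`, hence equal to `d / n`
(`card_mul_sum_sq_apply`). A single `e j` may still be peaked, so `e` is mixed by an orthogonal
matrix `H` with `H i j ^ 2 ≤ 2 / d` after random sign changes: `f i = ∑ j, H i j * ε j • e j`. This
is orthonormal for every `ε`, and each `√n * f i v` is a Rademacher sum of variance at most 2.
Subgaussian tails and a union bound over the `d * n ≤ n ^ 2` values give one `ε` with all of them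
`O(√log n)`. -/

/-- A sum of `d`-th roots of unity with frequency `m` is real, and vanishes when `d ∤ m`. -/
theorem sum_exp_two_pi_mul_div (d : ℕ) (hd : d ≠ 0) (m : ℤ) :
    ∑ j : Fin d, Complex.exp (((2 * Real.pi * m * (j : ℕ) / d : ℝ) : ℂ) * Complex.I) =
      if (d : ℤ) ∣ m then (d : ℂ) else 0 := by
  have hd' : (d : ℂ) ≠ 0 := by exact_mod_cast hd
  set ζ : ℂ := Complex.exp (2 * Real.pi * m / d * Complex.I) with hζ
  have hterm (j : ℕ) :
      Complex.exp (((2 * Real.pi * m * j / d : ℝ) : ℂ) * Complex.I) = ζ ^ j := by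
    rw [hζ, ← Complex.exp_nat_mul]
    congr 1
    push_cast
    ring
  simp_rw [hterm]
  rw [Fin.sum_univ_eq_sum_range (fun j => ζ ^ j)]
  have hpow : ζ ^ d = 1 := by
    rw [hζ, ← Complex.exp_nat_mul, Complex.exp_eq_one_iff]
    exact ⟨m, by field_simp⟩
  have hone : ζ = 1 ↔ (d : ℤ) ∣ m := by
    rw [hζ, Complex.exp_eq_one_iff]
    constructor
    · rintro ⟨k, hk⟩
      refine ⟨k, ?_⟩
      have h2 : (2 * Real.pi * Complex.I : ℂ) ≠ 0 := Complex.two_pi_I_ne_zero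
      have : (2 * Real.pi * Complex.I : ℂ) * m = (2 * Real.pi * Complex.I) * (d * k) := by
        field_simp at hk
        linear_combination (2 * Real.pi * Complex.I : ℂ) * hk
      exact_mod_cast mul_left_cancel₀ h2 this
    · rintro ⟨k, rfl⟩
      refine ⟨k, ?_⟩
      push_cast
      field_simp
  split_ifs with h
  · rw [hone.2 h]
    simp
  · have h1 : ζ - 1 ≠ 0 := sub_ne_zero.2 (mt hone.1 h)
    have := mul_geom_sum ζ d
    rw [hpow, sub_self] at this
    exact (mul_eq_zero.1 this).resolve_left h1

/-- The discrete Hartley transform: a real orthogonal matrix with entries of size `O(1 / √d)`. -/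
theorem exists_flat_orthogonal_matrix (d : ℕ) :
    ∃ H : Fin d → Fin d → ℝ,
      (∀ i k, ∑ j, H i j * H k j = if i = k then 1 else 0) ∧ ∀ i j, H i j ^ 2 ≤ 2 / d := by
  rcases eq_or_ne d 0 with rfl | hd
  · exact ⟨fun _ _ => 0, fun i => i.elim0, fun i => i.elim0⟩
  have hd' : (0 : ℝ) < d := by exact_mod_cast Nat.pos_of_ne_zero hd
  have hcos (m : ℤ) : ∑ j : Fin d, Real.cos (2 * Real.pi * m * (j : ℕ) / d) =
      if (d : ℤ) ∣ m then (d : ℝ) else 0 := by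
    have := congrArg Complex.re (sum_exp_two_pi_mul_div d hd m)
    simp only [Complex.re_sum, Complex.exp_ofReal_mul_I_re] at this
    rw [this]
    split_ifs <;> simp
  have hsin (m : ℤ) : ∑ j : Fin d, Real.sin (2 * Real.pi * m * (j : ℕ) / d) = 0 := by
    have := congrArg Complex.im (sum_exp_two_pi_mul_div d hd m)
    simp only [Complex.im_sum, Complex.exp_ofReal_mul_I_im] at this
    rw [this]
    split_ifs <;> simp
  let θ (i j : Fin d) : ℝ := 2 * Real.pi * (i : ℕ) * (j : ℕ) / d
  have hsq : √(d : ℝ) ^ 2 = d := Real.sq_sqrt hd'.le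
  have hsq0 : √(d : ℝ) ≠ 0 := (Real.sqrt_pos.2 hd').ne'
  refine ⟨fun i j => (Real.cos (θ i j) + Real.sin (θ i j)) / √d, fun i k => ?_, fun i j => ?_⟩
  -- With cas = cos + sin, cas x · cas y = cos (x - y) + sin (x + y). Summed over `j`, the sines
  -- vanish and the cosines detect `i = k`.
  · have hterm (j : Fin d) :
        (Real.cos (θ i j) + Real.sin (θ i j)) / √d * ((Real.cos (θ k j) + Real.sin (θ k j)) / √d) =
          (Real.cos (2 * Real.pi * ((i : ℤ) - (k : ℤ) : ℤ) * (j : ℕ) / d) +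
            Real.sin (2 * Real.pi * ((i : ℤ) + (k : ℤ) : ℤ) * (j : ℕ) / d)) / d := by
      have h1 : 2 * Real.pi * ((i : ℤ) - (k : ℤ) : ℤ) * (j : ℕ) / d = θ i j - θ k j := by
        simp only [θ]
        push_cast
        ring
      have h2 : 2 * Real.pi * ((i : ℤ) + (k : ℤ) : ℤ) * (j : ℕ) / d = θ i j + θ k j := by
        simp only [θ]
        push_cast
        ring
      rw [h1, h2, Real.cos_sub, Real.sin_add, div_mul_div_comm, ← sq, hsq]
      ring
    simp_rw [hterm]
    rw [← Finset.sum_div, Finset.sum_add_distrib, hcos, hsin]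
    have hiff : (d : ℤ) ∣ (i : ℤ) - (k : ℤ) ↔ i = k := by
      constructor
      · intro h
        have := Int.eq_zero_of_abs_lt_dvd h (by rw [abs_lt]; constructor <;> omega)
        exact Fin.ext (by omega)
      · rintro rfl
        simp
    simp only [hiff]
    split_ifs
    · field_simp
      simp
    · simp
  · rw [div_pow, hsq]
    gcongr
    nlinarith [sq_nonneg (Real.cos (θ i j) - Real.sin (θ i j)), Real.sin_sq_add_cos_sq (θ i j)]

/-! ### Random signs -/

/-- The moment generating function of a Rademacher sum. -/
theorem sum_signs_exp {J : Type*} [Fintype J] [DecidableEq J] (a : J → ℝ) :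
    ∑ ε : J → ℤˣ, Real.exp (∑ j, ((ε j : ℤ) : ℝ) * a j) = ∏ j, (2 * Real.cosh (a j)) := by
  have h := Finset.prod_univ_sum (fun _ : J => (Finset.univ : Finset ℤˣ))
    (fun j (x : ℤˣ) => Real.exp (((x : ℤ) : ℝ) * a j))
  simp_rw [Real.exp_sum]
  rw [Fintype.piFinset_univ] at h
  rw [← h]
  refine Finset.prod_congr rfl fun j _ => ?_
  rw [Real.cosh_eq, UnitsInt.univ]
  rw [Finset.sum_pair (by decide)]
  simp
  ring

/-- Subgaussian bound from cosh x ≤ exp (x² / 2); using cosh of the sum controls both tails at once.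
-/
theorem sum_signs_cosh_le {J : Type*} [Fintype J] [DecidableEq J] (a : J → ℝ) {σ : ℝ}
    (ha : ∑ j, a j ^ 2 ≤ σ) :
    ∑ ε : J → ℤˣ, Real.cosh (∑ j, ((ε j : ℤ) : ℝ) * a j) ≤
      ∑ _ε : J → ℤˣ, Real.exp (σ / 2) := by
  have hneg : ∑ ε : J → ℤˣ, Real.exp (-∑ j, ((ε j : ℤ) : ℝ) * a j) =
      ∏ j, (2 * Real.cosh (a j)) := by
    have := sum_signs_exp fun j => -a j
    simpa using this
  have hprod : ∏ j, (2 * Real.cosh (a j)) ≤ 2 ^ Fintype.card J * Real.exp (σ / 2) := by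
    rw [Finset.prod_mul_distrib, Finset.prod_const, Finset.card_univ]
    gcongr
    calc ∏ j, Real.cosh (a j) ≤ ∏ j, Real.exp (a j ^ 2 / 2) :=
          Finset.prod_le_prod (fun j _ => (Real.cosh_pos _).le)
            fun j _ => Real.cosh_le_exp_half_sq _
      _ ≤ Real.exp (σ / 2) := by
          rw [← Real.exp_sum, ← Finset.sum_div]
          gcongr
  simp_rw [Real.cosh_eq]
  rw [← Finset.sum_div, Finset.sum_add_distrib, sum_signs_exp, hneg]
  simp
  linarith

/-- A family of linear forms with small `ℓ²` norms is simultaneously small at some sign vector. -/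
theorem exists_signs_abs_sum_le {I J : Type*} [Fintype I] [Fintype J] (a : I → J → ℝ)
    {σ t : ℝ} (ha : ∀ i, ∑ j, a i j ^ 2 ≤ σ) (hσ : 0 < σ) (ht : 0 < t)
    (hI : 2 * (Fintype.card I : ℝ) < Real.exp (t ^ 2 / (2 * σ))) :
    ∃ ε : J → ℝ, (∀ j, ε j * ε j = 1) ∧ ∀ i, |∑ j, ε j * a i j| ≤ t := by
  classical
  -- The Chernoff parameter minimising `s ^ 2 * σ / 2 - s * t`.
  set s : ℝ := t / σ with hs
  have hs0 : 0 < s := by positivity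
  have hsum : ∑ ε : J → ℤˣ, ∑ i, Real.cosh (∑ j, ((ε j : ℤ) : ℝ) * (s * a i j)) ≤
      ∑ _ε : J → ℤˣ, ∑ _i : I, Real.exp (s ^ 2 * σ / 2) := by
    rw [Finset.sum_comm, Finset.sum_comm (s := (Finset.univ : Finset (J → ℤˣ)))]
    refine Finset.sum_le_sum fun i _ => sum_signs_cosh_le _ ?_
    simp_rw [mul_pow]
    rw [← Finset.mul_sum]
    gcongr
    exact ha i
  -- Some `ε` does no worse than average on the sum over `i`; since every cosh is positive, this
  -- bounds each form separately.
  obtain ⟨ε, -, hε⟩ := Finset.exists_le_of_sum_le Finset.univ_nonempty hsum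
  refine ⟨fun j => ((ε j : ℤ) : ℝ), fun j => ?_, fun i => ?_⟩
  · rcases Int.units_eq_one_or (ε j) with h | h <;> simp [h]
  set X : ℝ := ∑ j, ((ε j : ℤ) : ℝ) * a i j with hX
  have hsX : ∑ j, ((ε j : ℤ) : ℝ) * (s * a i j) = s * X := by
    rw [hX, Finset.mul_sum]
    exact Finset.sum_congr rfl fun j _ => by ring
  have h1 : Real.cosh (s * X) ≤ Fintype.card I * Real.exp (s ^ 2 * σ / 2) := by
    rw [← hsX]
    refine (Finset.single_le_sum (f := fun i => Real.cosh (∑ j, ((ε j : ℤ) : ℝ) * (s * a i j)))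
      (fun i _ => (Real.cosh_pos _).le) (Finset.mem_univ i)).trans (hε.trans_eq ?_)
    simp
  have h2 : Real.exp (s * |X|) ≤ 2 * Real.cosh (s * X) := by
    rw [← Real.cosh_abs, abs_mul, abs_of_pos hs0, Real.cosh_eq]
    linarith [Real.exp_pos (-(s * |X|))]
  have h3 : Real.exp (s * |X|) < Real.exp (s * t) := by
    calc Real.exp (s * |X|) ≤ 2 * Fintype.card I * Real.exp (s ^ 2 * σ / 2) := by linarith
      _ < Real.exp (t ^ 2 / (2 * σ)) * Real.exp (s ^ 2 * σ / 2) := by gcongr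
      _ = Real.exp (s * t) := by
          rw [← Real.exp_add, hs]
          congr 1
          field_simp
          ring
  exact (lt_of_mul_lt_mul_left (Real.exp_lt_exp.1 h3) hs0.le).le

theorem coe_sum_smul_apply {V : Type*} {W : Submodule ℝ (EuclideanSpace ℝ V)} {ι : Type*} [Fintype ι]
    (c : ι → ℝ) (e : ι → W) (v : V) :
    ((∑ j, c j • e j : W) : EuclideanSpace ℝ V) v =
      ∑ j, c j * (e j : EuclideanSpace ℝ V) v := by
  simp

/-! ### Transitively invariant subspaces -/

section Subspace

variable {V : Type*} [Fintype V]

/-- `W` is invariant under a transitive set of coordinate permutations. -/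
def IsTransitivelyInvariant (W : Submodule ℝ (EuclideanSpace ℝ V)) : Prop :=
  ∀ u v : V, ∃ φ : V ≃ V, φ u = v ∧ ∀ x ∈ W, WithLp.toLp 2 (fun w => x (φ w)) ∈ W

/-- The vector `p` represents evaluation at `v` on `W`, so `‖p‖ ^ 2 = p v = K`. Its translate `q` in
`W` has the same norm and `q u = K`; Cauchy–Schwarz at `u` gives `K ^ 2 ≤ K * ∑ j, e j u ^ 2`. -/
theorem IsTransitivelyInvariant.sum_sq_apply_le {W : Submodule ℝ (EuclideanSpace ℝ V)}
    (hW : IsTransitivelyInvariant W) {ι : Type*} [Fintype ι] (e : OrthonormalBasis ι ℝ W)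
    (u v : V) :
    ∑ j, (e j : EuclideanSpace ℝ V) v ^ 2 ≤ ∑ j, (e j : EuclideanSpace ℝ V) u ^ 2 := by
  obtain ⟨φ, hφ, hφW⟩ := hW u v
  set K := ∑ j, (e j : EuclideanSpace ℝ V) v ^ 2 with hK
  set p : W := ∑ j, (e j : EuclideanSpace ℝ V) v • e j with hp
  have hpv : (p : EuclideanSpace ℝ V) v = K := by
    rw [hp, coe_sum_smul_apply, hK]
    exact Finset.sum_congr rfl fun j _ => (sq _).symm
  have hpn : ‖p‖ ^ 2 = K := by
    rw [← e.sum_sq_inner_right, hK]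
    refine Finset.sum_congr rfl fun j _ => ?_
    rw [hp, e.orthonormal.inner_right_fintype]
  set q : W := ⟨WithLp.toLp 2 (fun w => (p : EuclideanSpace ℝ V) (φ w)), hφW p p.2⟩ with hq
  have hqn : ‖q‖ ^ 2 = K := by
    rw [← hpn, Submodule.coe_norm, Submodule.coe_norm, EuclideanSpace.norm_sq_eq,
      EuclideanSpace.norm_sq_eq]
    exact Equiv.sum_comp φ fun w => ‖(p : EuclideanSpace ℝ V) w‖ ^ 2
  have hqu : ∑ j, inner ℝ (e j) q * (e j : EuclideanSpace ℝ V) u = K := by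
    rw [← coe_sum_smul_apply, e.sum_repr', ← hpv, ← hφ]
  have hcs := Finset.sum_mul_sq_le_sq_mul_sq Finset.univ (fun j => inner ℝ (e j) q)
    (fun j => (e j : EuclideanSpace ℝ V) u)
  rw [hqu, e.sum_sq_inner_right, hqn] at hcs
  rcases (show 0 ≤ K from Finset.sum_nonneg fun j _ => sq_nonneg _).eq_or_lt with h | h
  · rw [← h]
    exact Finset.sum_nonneg fun j _ => sq_nonneg _
  · rw [sq] at hcs
    exact le_of_mul_le_mul_left hcs h

theorem IsTransitivelyInvariant.card_mul_sum_sq_apply {W : Submodule ℝ (EuclideanSpace ℝ V)}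
    (hW : IsTransitivelyInvariant W) {ι : Type*} [Fintype ι] (e : OrthonormalBasis ι ℝ W)
    (v : V) :
    Fintype.card V * ∑ j, (e j : EuclideanSpace ℝ V) v ^ 2 = Fintype.card ι := by
  calc (Fintype.card V : ℝ) * ∑ j, (e j : EuclideanSpace ℝ V) v ^ 2
      = ∑ u : V, ∑ j, (e j : EuclideanSpace ℝ V) u ^ 2 := by
        rw [Finset.sum_congr rfl fun u _ =>
          le_antisymm (hW.sum_sq_apply_le e v u) (hW.sum_sq_apply_le e u v)]
        simp
    _ = ∑ j, ‖e j‖ ^ 2 := by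
        rw [Finset.sum_comm]
        refine Finset.sum_congr rfl fun j _ => ?_
        rw [Submodule.coe_norm, EuclideanSpace.norm_sq_eq]
        simp
    _ = Fintype.card ι := by simp

/-- A transitively invariant subspace has an orthonormal basis of flat vectors. -/
theorem IsTransitivelyInvariant.exists_flat_orthonormalBasis
    {W : Submodule ℝ (EuclideanSpace ℝ V)} (hW : IsTransitivelyInvariant W)
    (hV : 2 ≤ Fintype.card V) :
    ∃ f : OrthonormalBasis (Fin (Module.finrank ℝ W)) ℝ W, ∀ i v,
      √(Fintype.card V) * |(f i : EuclideanSpace ℝ V) v| ≤ 4 * √(Real.log (Fintype.card V)) := by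
  set n := Fintype.card V with hn
  set d := Module.finrank ℝ W with hd
  have hn0 : (0 : ℝ) < n := by exact_mod_cast (by omega : 0 < n)
  have hdn : d ≤ n := by
    simpa [hd, hn] using Submodule.finrank_le W
  have hlog : 0 < Real.log n := Real.log_pos (by exact_mod_cast hV)
  obtain ⟨H, hH, hHle⟩ := exists_flat_orthogonal_matrix d
  let e := stdOrthonormalBasis ℝ W
  obtain ⟨ε, hε, hbound⟩ := exists_signs_abs_sum_le
    (I := Fin d × V) (J := Fin d)
    (fun i j => √n * (H i.1 j * (e j : EuclideanSpace ℝ V) i.2))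
    (σ := 2) (t := 4 * √(Real.log n)) (fun ⟨i, v⟩ => by
      have hd0 : (0 : ℝ) < d := by exact_mod_cast i.pos
      calc ∑ j, (√n * (H i j * (e j : EuclideanSpace ℝ V) v)) ^ 2
          ≤ ∑ j, n * (2 / d * (e j : EuclideanSpace ℝ V) v ^ 2) := by
            refine Finset.sum_le_sum fun j _ => ?_
            rw [mul_pow, mul_pow, Real.sq_sqrt hn0.le]
            gcongr
            exact hHle i j
        _ = 2 / d * (n * ∑ j, (e j : EuclideanSpace ℝ V) v ^ 2) := by
            simp_rw [Finset.mul_sum]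
            exact Finset.sum_congr rfl fun j _ => by ring
        _ ≤ 2 := by
            rw [hW.card_mul_sum_sq_apply e v, Fintype.card_fin]
            field_simp
            exact le_rfl) two_pos (by positivity) (by
      -- The constant 4 makes the exponential `n ^ 4`, which beats `2 * d * n ≤ n ^ 3`.
      have hexp : Real.exp ((4 * √(Real.log n)) ^ 2 / (2 * 2)) = (n : ℝ) ^ 4 := by
        rw [mul_pow, Real.sq_sqrt hlog.le, ← Real.exp_log (pow_pos hn0 4), Real.log_pow]
        congr 1
        push_cast
        ring
      rw [hexp, Fintype.card_prod, Fintype.card_fin]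
      have : 2 * (d * n) < n ^ 4 := by
        calc 2 * (d * n) ≤ n * (n * n) := by gcongr
          _ < n * (n * n) * n := by
            refine lt_mul_of_one_lt_right (by positivity) (by omega)
          _ = n ^ 4 := by ring
      exact_mod_cast this)
  let f : Fin d → W := fun i => ∑ j, (H i j * ε j) • e j
  have hf : Orthonormal ℝ f := by
    rw [orthonormal_iff_ite]
    intro i k
    rw [e.orthonormal.inner_sum, ← hH i k]
    refine Finset.sum_congr rfl fun j _ => ?_
    simp only [conj_trivial]
    linear_combination H i j * H k j * hε j
  -- The family already has `d = dim W` members, so extending from `Set.univ` merely repackages it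
  -- as a basis.
  obtain ⟨b, hb⟩ := Orthonormal.exists_orthonormalBasis_extension_of_card_eq
    (ι := Fin d) (by simp [hd]) (v := f) (s := Set.univ)
    (hf.comp _ Subtype.val_injective)
  refine ⟨b, fun i v => ?_⟩
  rw [hb i trivial, coe_sum_smul_apply, ← abs_of_nonneg (Real.sqrt_nonneg (n : ℝ)), ← abs_mul]
  refine le_of_eq_of_le ?_ (hbound (i, v))
  rw [Finset.mul_sum]
  exact congrArg _ (Finset.sum_congr rfl fun j _ => by ring)

end Subspace

/-! ### Eigenspaces of vertex-transitive graphs -/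

theorem mulVec_adjMatrix_comp_iso {V : Type*} [Fintype V] {G : SimpleGraph V} [DecidableRel G.Adj]
    (φ : G ≃g G) (x : V → ℝ) (w : V) :
    (G.adjMatrix ℝ).mulVec (fun u => x (φ u)) w = (G.adjMatrix ℝ).mulVec x (φ w) := by
  simp only [Matrix.mulVec, dotProduct, SimpleGraph.adjMatrix_apply]
  rw [← Equiv.sum_comp φ.toEquiv fun u => (if G.Adj (φ w) u then (1 : ℝ) else 0) * x u]
  refine Finset.sum_congr rfl fun u _ => ?_
  simp [φ.map_adj_iff]

theorem IsVertexTransitive.isTransitivelyInvariant_eigenspace {V : Type*} [Fintype V]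
    [DecidableEq V] {G : SimpleGraph V} [DecidableRel G.Adj] (hG : IsVertexTransitive G) (μ : ℝ) :
    IsTransitivelyInvariant
      (Module.End.eigenspace (Matrix.toEuclideanLin (G.adjMatrix ℝ)) μ) := by
  intro u v
  obtain ⟨φ, hφ⟩ := hG u v
  refine ⟨φ.toEquiv, hφ, fun x hx => ?_⟩
  rw [Module.End.mem_eigenspace_iff] at hx ⊢
  ext w
  have h1 : (G.adjMatrix ℝ).mulVec x.ofLp (φ w) = μ * x (φ w) :=
    congrFun (congrArg WithLp.ofLp hx) (φ w)
  exact (mulVec_adjMatrix_comp_iso φ x.ofLp w).trans h1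

theorem theorem1p4 :
    ∃ C : ℝ, 0 < C ∧
      ∀ (V : Type*) [Fintype V] (G : SimpleGraph V) [DecidableRel G.Adj],
        2 ≤ Fintype.card V → IsVertexTransitive G →
          ∃ b : Module.Basis (Fin (Fintype.card V)) ℝ (V → ℝ),
            IsAvgOrthonormal b ∧
            (∀ i, IsEigenfunction G (b i)) ∧
            ∀ i, IsBoundedBy (C * √(Real.log (Fintype.card V))) (b i) := by
  refine ⟨4, by norm_num, fun V _ G _ hV hG => ?_⟩
  classical
  set n := Fintype.card V with hn
  have hn0 : (0 : ℝ) < n := by exact_mod_cast (by omega : 0 < n)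
  have hs0 : √(n : ℝ) ≠ 0 := (Real.sqrt_pos.2 hn0).ne'
  set T := Matrix.toEuclideanLin (G.adjMatrix ℝ) with hTdef
  have hT : T.IsSymmetric :=
    Matrix.isSymmetric_toEuclideanLin_iff.2 (by
      rw [Matrix.IsHermitian, Matrix.conjTranspose_eq_transpose_of_trivial,
        SimpleGraph.transpose_adjMatrix])
  choose f hf using fun μ : Module.End.Eigenvalues T =>
    (hG.isTransitivelyInvariant_eigenspace (μ : ℝ)).exists_flat_orthonormalBasis hV
  let B := hT.direct_sum_isInternal.collectedOrthonormalBasis hT.orthogonalFamily_eigenspaces' f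
  have hBval (a) : B a = (f a.1 a.2 : EuclideanSpace ℝ V) := by
    simp [B, DirectSum.IsInternal.collectedOrthonormalBasis]
  have hcard : Fintype.card (Σ μ : Module.End.Eigenvalues T,
      Fin (Module.finrank ℝ (Module.End.eigenspace T μ))) = n := by
    rw [← Module.finrank_eq_card_basis B.toBasis, finrank_euclideanSpace]
  let E := Fintype.equivFinOfCardEq hcard
  -- The factor `√n` passes from the Euclidean to the averaging inner product.
  let b : Module.Basis (Fin n) ℝ (V → ℝ) :=
    ((B.toBasis.reindex E).map (WithLp.linearEquiv 2 ℝ (V → ℝ))).isUnitSMul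
      (w := fun _ => √(n : ℝ)) fun _ => hs0.isUnit
  have hb (i : Fin n) (v : V) : b i v = √n * B (E.symm i) v := by
    simp [b, Module.Basis.isUnitSMul_apply]
  have hinner (i j : Fin n) : avgInner (b i) (b j) = if i = j then 1 else 0 := by
    have h := orthonormal_iff_ite.1 B.orthonormal (E.symm i) (E.symm j)
    rw [PiLp.inner_apply] at h
    simp only [E.symm.injective.eq_iff] at h
    rw [avgInner, Fintype.expect_eq_sum_div_card, ← hn, ← h, div_eq_iff hn0.ne', Finset.sum_mul]
    refine Finset.sum_congr rfl fun v _ => ?_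
    rw [hb, hb]
    simp only [RCLike.inner_apply, conj_trivial]
    linear_combination B (E.symm i) v * B (E.symm j) v * Real.mul_self_sqrt hn0.le
  refine ⟨b, ⟨fun i => by simp [hinner], fun i j hij => by simp [hinner, hij]⟩, fun i => ?_,
    fun i => ?_⟩
  · refine ⟨(E.symm i).1, Module.End.mem_eigenspace_iff.2 ?_, b.ne_zero i⟩
    have hmem : T (B (E.symm i)) = ((E.symm i).1 : ℝ) • B (E.symm i) := by
      rw [hBval]
      exact Module.End.mem_eigenspace_iff.1 (f (E.symm i).1 (E.symm i).2).2
    have hbi : b i = √(n : ℝ) • (B (E.symm i)).ofLp := funext fun v => hb i v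
    have h := congrArg WithLp.ofLp hmem
    rw [hbi, map_smul, smul_comm]
    exact congrArg _ h
  · refine (pi_norm_le_iff_of_nonneg (by positivity)).2 fun v => ?_
    rw [hb, hBval, Real.norm_eq_abs, abs_mul, abs_of_nonneg (Real.sqrt_nonneg _)]
    exact hf _ _ v
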